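/- Let $\mathcal S$ be the set of all finite permutations (written in one-line notation, including the empty one), and let $\pi\le\sigma$ mean that $\sigma$ contains a subsequence order-isomorphic to $\pi$. For a set $X$ of permutations let $X_n$ (respectively $X_{\le n}$) be the set of its elements of size $n$ (respectively at most $n$), and let $\operatorname{Av}(X)$ be the set of permutations $\sigma$ with $\pi\not\le\sigma$ for all $\pi\in X$. A class is a subset of $\mathcal S$ that is downward closed under $\le$. A class $\mathcal C$ is uniquely-Wilf if for every $n$ and all $\pi,\sigma\in\mathcal C_n$ the classes $\mathcal C\cap\operatorname{Av}(\pi)$ and $\mathcal C\cap\operatorname{Av}(\sigma)$ have the same enumeration sequence, i.e. $|(\mathcal C\cap\operatorname{Av}(\pi))_m|=|(\mathcal C\cap\operatorname{Av}(\sigma))_m|$ for all $m$. Let $\mathcal F\subseteq\mathcal S_{\le 3}$ be the finite class with $\mathcal F_3=\{123,132,231,321\}$, and let $\mathcal F^{\uparrow}=\operatorname{Av}(\mathcal S_{\le 3}\setminus\mathcal F)$. Then $\mathcal F^{\uparrow}=\operatorname{Av}(213,312)$, and $\mathcal F^{\uparrow}$ is the only infinite uniquely-Wilf class $\mathcal C$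 with $\mathcal C_{\le 3}=\mathcal F$; that is, $\operatorname{Av}(213,312)$ is infinite and uniquely-Wilf and restricts to $\mathcal F$ in sizes at most $3$, and every infinite uniquely-Wilf class $\mathcal C$ with $\mathcal C_{\le 3}=\mathcal F$ equals $\operatorname{Av}(213,312)$. -/

import Mathlib

/-- A finite permutation: a size `n` together with a permutation of `Fin n`
(the entries `1, …, n` of one-line notation are shifted down by one). -/
abbrev FinPerm : Type := Σ n : ℕ, Equiv.Perm (Fin n)

namespace FinPerm

/-- The size of a permutation. -/
def size (π : FinPerm) : ℕ := π.1

/-- Classical pattern containment `π ≤ σ`: the one-line notation of `σ` has a subsequence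
(at the positions picked by `f`) that is order-isomorphic to `π`. -/
def Contains (π σ : FinPerm) : Prop :=
  ∃ f : Fin π.1 ↪o Fin σ.1, ∀ i j, π.2 i < π.2 j ↔ σ.2 (f i) < σ.2 (f j)

/-- The permutations of size `n`. -/
def ofSize (n : ℕ) : Set FinPerm := {π | π.size = n}

/-- The permutations of size at most `n`. -/
def sizeLE (n : ℕ) : Set FinPerm := {π | π.size ≤ n}

/-- `Av(X)`: the permutations that involve no element of `X`. -/
def Av (X : Set FinPerm) : Set FinPerm := {σ | ∀ π ∈ X, ¬ Contains π σ}

/-- A permutation class: a set of permutations closed downwards under containment. -/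
def IsPermClass (C : Set FinPerm) : Prop :=
  ∀ π σ : FinPerm, Contains π σ → σ ∈ C → π ∈ C

/-- The enumeration sequence of a set of permutations. -/
noncomputable def enumSeq (X : Set FinPerm) (n : ℕ) : ℕ := (X ∩ ofSize n).ncard

/-- The sets counted by `enumSeq` are finite, so that `Set.ncard` is their true cardinality. -/
theorem finite_inter_ofSize (X : Set FinPerm) (n : ℕ) : (X ∩ ofSize n).Finite := by
  refine (Set.finite_range (fun p : Equiv.Perm (Fin n) => (⟨n, p⟩ : FinPerm))).subset ?_
  rintro ⟨m, p⟩ ⟨_, h⟩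
  have h' : m = n := h
  subst h'
  exact ⟨p, rfl⟩

/-- Wilf-equivalence relative to `C` (for permutations `π`, `σ` in `C`): the classes
`C ∩ Av(π)` and `C ∩ Av(σ)` have the same enumeration sequence. -/
def WilfEquiv (C : Set FinPerm) (π σ : FinPerm) : Prop :=
  enumSeq (C ∩ Av {π}) = enumSeq (C ∩ Av {σ})

/-- `C` is uniquely-Wilf: for every `n`, all permutations of size `n` in `C` are
Wilf-equivalent relative to `C`. -/
def UniquelyWilf (C : Set FinPerm) : Prop :=
  ∀ n : ℕ, ∀ π ∈ C ∩ ofSize n, ∀ σ ∈ C ∩ ofSize n, WilfEquiv C π σ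

/-- `F^↑ = Av(S_{≤ n} \ F)`, for a set `F` of permutations of size at most `n`. -/
def upper (n : ℕ) (F : Set FinPerm) : Set FinPerm := Av (sizeLE n \ F)

/-- The permutation 123. -/
def p123 : FinPerm := ⟨3, ⟨![0, 1, 2], ![0, 1, 2], by decide, by decide⟩⟩
/-- The permutation 132. -/
def p132 : FinPerm := ⟨3, ⟨![0, 2, 1], ![0, 2, 1], by decide, by decide⟩⟩
/-- The permutation 213. -/
def p213 : FinPerm := ⟨3, ⟨![1, 0, 2], ![1, 0, 2], by decide, by decide⟩⟩
/-- The permutation 231. -/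
def p231 : FinPerm := ⟨3, ⟨![1, 2, 0], ![2, 0, 1], by decide, by decide⟩⟩
/-- The permutation 312. -/
def p312 : FinPerm := ⟨3, ⟨![2, 0, 1], ![1, 2, 0], by decide, by decide⟩⟩
/-- The permutation 321. -/
def p321 : FinPerm := ⟨3, ⟨![2, 1, 0], ![2, 1, 0], by decide, by decide⟩⟩

end FinPerm

/-! In a permutation avoiding 213 and 312 every value lies to the left of all larger values or to
the right of all of them. Recording this as L or R for each value but the largest identifies
containment with the subword order (`contains_ofWord_iff`). The number of words of length m avoiding
u depends only on the length of u, so the whole class is uniquely-Wilf.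

For uniqueness, let D be an infinite uniquely-Wilf lower set of words containing all words of length
2. By induction, D contains every word avoiding some word of length k + 2. Wilf-equivalence with a
power of R puts long block words and many L's into one word of D; by pigeonhole that word contains a
long star word (`exists_starWord_sublist`). Long star words contain all words avoiding some L^i R
L^r (`sublist_starWord`), so D contains these, and equality of counts spreads this to all words of
the same length (`avoiders_subset_of_one`). Each word avoids something long enough, so D is
everything. -/

/-! ### Binary words avoiding a subword -/

namespace BinWord

/-- The words of length `m` in `D` of which `u` is not a subword. -/
def avoiders (D : Set (List Bool)) (u : List Bool) (m : ℕ) : Set (List Bool) :=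
  {w | w ∈ D ∧ w.length = m ∧ ¬ u.Sublist w}

theorem finite_avoiders (D : Set (List Bool)) (u : List Bool) (m : ℕ) :
    (avoiders D u m).Finite :=
  (List.finite_length_eq Bool m).subset fun _ h => h.2.1

/-- Greedy matching: a first letter b may be used for the head of the pattern, and any other first
letter is useless. The resulting recursion does not see which letter b is. -/
theorem avoiders_univ_cons (b : Bool) (u : List Bool) (m : ℕ) :
    avoiders Set.univ (b :: u) (m + 1) =
      List.cons b '' avoiders Set.univ u m ∪
        List.cons (!b) '' avoiders Set.univ (b :: u) m := by
  ext w
  rcases w with _ | ⟨c, w⟩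
  · simp [avoiders]
  · by_cases hc : c = b
    · subst hc
      simp [avoiders]
    · have hc' : c = !b := by cases b <;> cases c <;> simp_all
      subst hc'
      have : ((b :: u).Sublist ((!b) :: w)) ↔ (b :: u).Sublist w :=
        ⟨fun h => by
          simpa [List.sublist_cons_iff] using h, fun h => h.cons _⟩
      simp [avoiders, this]

theorem ncard_avoiders_univ_cons (b : Bool) (u : List Bool) (m : ℕ) :
    (avoiders Set.univ (b :: u) (m + 1)).ncard =
      (avoiders Set.univ u m).ncard + (avoiders Set.univ (b :: u) m).ncard := by
  rw [avoiders_univ_cons, Set.ncard_union_eq _ ((finite_avoiders _ _ _).image _)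
    ((finite_avoiders _ _ _).image _), Set.ncard_image_of_injective _ List.cons_injective,
    Set.ncard_image_of_injective _ List.cons_injective]
  rw [Set.disjoint_left]
  rintro _ ⟨x, _, rfl⟩ ⟨y, _, h⟩
  simp at h

/-- The number of words of length `m` avoiding `u` depends only on the length of `u`. -/
theorem ncard_avoiders_univ_congr (m : ℕ) :
    ∀ u v : List Bool, u.length = v.length →
      (avoiders Set.univ u m).ncard = (avoiders Set.univ v m).ncard := by
  induction m with
  | zero =>
    intro u v h
    congr 1
    ext w
    simp only [avoiders, Set.mem_ofPred_eq, List.length_eq_zero_iff]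
    refine and_congr_right fun _ => and_congr_right fun hw => ?_
    subst hw
    rw [List.sublist_nil, List.sublist_nil, ← List.length_eq_zero_iff, h,
      List.length_eq_zero_iff]
  | succ m ih =>
    intro u v h
    match u, v, h with
    | [], [], _ => rfl
    | b :: u, c :: v, h =>
      rw [ncard_avoiders_univ_cons, ncard_avoiders_univ_cons, ih u v (by simpa using h),
        ih (b :: u) (c :: v) h]

/-! ### Block words and star words -/

theorem eq_replicate_or_split (c : Bool) (w : List Bool) :
    w = List.replicate w.length c ∨ ∃ n w', w = List.replicate n c ++ (!c) :: w' := by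
  induction w with
  | nil => simp
  | cons d w ih =>
    by_cases hd : d = c
    · subst hd
      rcases ih with h | ⟨n, w', h⟩
      · left
        rw [List.length_cons, List.replicate_succ, ← h]
      · right
        exact ⟨n + 1, w', by rw [h, List.replicate_succ, List.cons_append]⟩
    · right
      exact ⟨0, w, by cases c <;> cases d <;> simp_all⟩

/-- The word `R^a L R^a L ⋯ L R^a` with `k` blocks `R^a` (`R = false`, `L = true`). -/
def blockWord (a : ℕ) : ℕ → List Bool
  | 0 => []
  | 1 => List.replicate a false
  | k + 2 => List.replicate a false ++ true :: blockWord a (k + 1)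

/-- The word `(R^a L)^i L^a (R^a L ⋯ L R^a)` with `r` blocks in the last group. -/
def starWord (a : ℕ) : ℕ → ℕ → List Bool
  | 0, r => List.replicate a true ++ blockWord a r
  | i + 1, r => List.replicate a false ++ true :: starWord a i r

/-- The word `L^i R L^r`. -/
def pat (i r : ℕ) : List Bool := List.replicate i true ++ false :: List.replicate r true

theorem length_pat (i r : ℕ) : (pat i r).length = i + r + 1 := by
  simp [pat, Nat.add_assoc]

theorem replicate_sublist_replicate_of_le {c : Bool} {m n : ℕ} (h : m ≤ n) :
    (List.replicate m c).Sublist (List.replicate n c) :=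
  (List.replicate_sublist_replicate c).2 h

theorem blockWord_mono {a b : ℕ} (h : a ≤ b) (k : ℕ) :
    (blockWord a k).Sublist (blockWord b k) := by
  induction k with
  | zero => exact List.Sublist.refl _
  | succ k ih =>
    rcases k with _ | k
    · exact replicate_sublist_replicate_of_le h
    · exact (replicate_sublist_replicate_of_le h).append (ih.cons_cons true)

theorem starWord_mono {a b : ℕ} (h : a ≤ b) (i r : ℕ) :
    (starWord a i r).Sublist (starWord b i r) := by
  induction i with
  | zero => exact (replicate_sublist_replicate_of_le h).append (blockWord_mono h r)
  | succ i ih => exact (replicate_sublist_replicate_of_le h).append (ih.cons_cons true)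

/-- Words with fewer than `k` letters `L` embed into block words. -/
theorem sublist_blockWord {a k : ℕ} {w : List Bool} (hk : w.count true < k)
    (ha : w.length ≤ a) : w.Sublist (blockWord a k) := by
  induction k generalizing w with
  | zero => omega
  | succ k ih =>
    rcases eq_replicate_or_split false w with h | ⟨n, w', h⟩
    · have h1 : w.Sublist (List.replicate a false) := by
        rw [h]
        exact replicate_sublist_replicate_of_le ha
      rcases k with _ | k
      · exact h1
      · exact h1.trans (List.sublist_append_left _ _)
    · subst h
      simp [List.count_replicate] at hk ha
      rcases k with _ | k
      · omega
      · exact (replicate_sublist_replicate_of_le (by omega)).append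
          ((ih (by omega) (by omega)).cons_cons true)

/-- Words avoiding `L^i R L^r` embed into star words. -/
theorem sublist_starWord {a i r : ℕ} {w : List Bool} (hw : ¬ (pat i r).Sublist w)
    (ha : w.length ≤ a) : w.Sublist (starWord a i r) := by
  induction i generalizing w with
  | zero =>
    rcases eq_replicate_or_split true w with h | ⟨n, w', h⟩
    · rw [h]
      exact (replicate_sublist_replicate_of_le ha).trans (List.sublist_append_left _ _)
    · subst h
      simp at ha
      refine (replicate_sublist_replicate_of_le (by omega)).append
        (sublist_blockWord ?_ (by simp; omega))
      -- With r letters L after its first R, the word would contain R L^r.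
      by_contra hc
      apply hw
      have h1 : (List.replicate r true).Sublist w' := by
        rw [List.replicate_sublist_iff]
        simpa using hc
      exact (h1.cons_cons false).trans (List.sublist_append_right _ _)
  | succ i ih =>
    rcases eq_replicate_or_split false w with h | ⟨n, w', h⟩
    · rw [h]
      exact (replicate_sublist_replicate_of_le ha).trans (List.sublist_append_left _ _)
    · subst h
      simp at ha
      refine (replicate_sublist_replicate_of_le (by omega)).append
        ((ih (fun hc => hw ?_) (by omega)).cons_cons true)
      have h1 : (pat (i + 1) r) = true :: pat i r := by simp [pat, List.replicate_succ]
      rw [h1]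
      exact (hc.cons_cons true).trans (List.sublist_append_right _ _)

/-- Cut the word so that both pieces contain R^a; one of them has enough L's. -/
theorem two_block_of_counts {a : ℕ} {w : List Bool}
    (hR : (List.replicate (a + a) false).Sublist w) (hL : 2 * a + 1 ≤ w.count true) :
    (List.replicate a true ++ List.replicate a false).Sublist w ∨
      (List.replicate a false ++ List.replicate (a + 1) true).Sublist w := by
  rw [List.replicate_add, List.append_sublist_iff] at hR
  obtain ⟨x, y, rfl, hx, hy⟩ := hR
  rw [List.count_append] at hL
  rcases le_or_gt a (x.count true) with h | h
  · exact Or.inl ((List.replicate_sublist_iff.2 h).append hy)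
  · exact Or.inr (hx.append (List.replicate_sublist_iff.2 (by omega)))

/-- A word containing a block word and many letters `L` contains a star word. -/
theorem exists_starWord_sublist {a b : ℕ} (hb : a + a ≤ b) (k : ℕ) {w : List Bool}
    (hw : (blockWord b (k + 1)).Sublist w) (hL : (k + 1) * (2 * a + 2) ≤ w.count true) :
    ∃ i r, i + r = k + 1 ∧ (starWord a i r).Sublist w := by
  have hbb : (List.replicate (a + a) false).Sublist (List.replicate b false) :=
    replicate_sublist_replicate_of_le hb
  induction k generalizing w with
  | zero =>
    rcases two_block_of_counts (hbb.trans hw) (by omega) with h | h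
    · exact ⟨0, 1, rfl, h⟩
    · refine ⟨1, 0, rfl, ?_⟩
      simpa [starWord, blockWord, List.replicate_succ] using h
  | succ k ih =>
    simp only [blockWord] at hw
    rw [List.append_sublist_iff] at hw
    obtain ⟨x, y, rfl, hx, hy⟩ := hw
    rw [← List.singleton_append, List.append_sublist_iff] at hy
    obtain ⟨z, y, rfl, hz, hy⟩ := hy
    obtain ⟨z₁, z₂, rfl⟩ := List.append_of_mem (List.singleton_sublist.1 hz)
    have hx : (List.replicate b false).Sublist (x ++ z₁) :=
      hx.trans (List.sublist_append_left _ _)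
    have hy : (blockWord b (k + 1)).Sublist (z₂ ++ y) :=
      hy.trans (List.sublist_append_right _ _)
    have hw : x ++ (z₁ ++ true :: z₂ ++ y) = (x ++ z₁) ++ true :: (z₂ ++ y) := by simp
    rw [hw] at hL ⊢
    generalize x ++ z₁ = x at *
    generalize z₂ ++ y = y at *
    -- Either the L's are plentiful after this separator, and induction applies there, or the part
    -- before it has at least 2a + 1 of them and the group L^a is found there.
    by_cases hc : (k + 1) * (2 * a + 2) ≤ y.count true
    · obtain ⟨i, r, hir, h⟩ := ih hy hc
      refine ⟨i + 1, r, by omega, ?_⟩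
      exact ((replicate_sublist_replicate_of_le (by omega : a ≤ b)).trans hx).append
        (h.cons_cons true)
    · have hy' := (blockWord_mono (by omega : a ≤ b) (k + 1)).trans hy
      have hx1 : 2 * a + 1 ≤ x.count true := by
        rw [List.count_append, List.count_cons_self] at hL
        have : (k + 1 + 1) * (2 * a + 2) = (k + 1) * (2 * a + 2) + (2 * a + 2) := by ring
        omega
      rcases two_block_of_counts (hbb.trans hx) hx1 with h | h
      · refine ⟨0, k + 2, by omega, ?_⟩
        have := h.append (hy'.cons_cons true)
        simpa [starWord, blockWord] using this
      · refine ⟨1, k + 1, by omega, ?_⟩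
        have := h.append (hy'.trans (List.sublist_cons_self true y))
        simpa [starWord, List.replicate_succ] using this

/-- If `u` contains the letter `c` and is avoided by as many words of length `m` in `D` as the
constant word of length `|u|` in the other letter, then some word of length `m` in `D` contains
`u` but not that constant word. -/
theorem exists_sublist_of_ncard_eq {D : Set (List Bool)} {c : Bool} {u : List Bool} {m : ℕ}
    (hm : u.length ≤ m) (hu : c ∈ u) (hR : List.replicate m (!c) ∈ D)
    (hW : (avoiders D u m).ncard =
      (avoiders D (List.replicate u.length (!c)) m).ncard) :
    ∃ w ∈ D, w.length = m ∧ u.Sublist w ∧ ¬ (List.replicate u.length (!c)).Sublist w := by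
  by_contra! hcon
  -- The inclusion is strict because the constant word of length m avoids `u`, which has a letter
  -- `c`.
  have hlt : avoiders D (List.replicate u.length (!c)) m ⊂ avoiders D u m := by
    refine Set.ssubset_iff_exists.2 ⟨fun w hw => ⟨hw.1, hw.2.1, fun h =>
      hw.2.2 (hcon w hw.1 hw.2.1 h)⟩, List.replicate m (!c), ⟨hR, by simp, fun h => ?_⟩,
      fun h => h.2.2 (replicate_sublist_replicate_of_le hm)⟩
    have := List.eq_of_mem_replicate (h.subset hu)
    cases c <;> simp at this
  have := Set.ncard_lt_ncard hlt (finite_avoiders _ _ _)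
  omega

/-! ### Uniquely-Wilf lower sets of words -/

section Class

variable {D : Set (List Bool)}

/-- Downward closed sets of words. -/
def IsLower (D : Set (List Bool)) : Prop := ∀ u w : List Bool, u.Sublist w → w ∈ D → u ∈ D

/-- Unique Wilf-equivalence of sets of words. -/
def IsWilf (D : Set (List Bool)) : Prop :=
  ∀ u ∈ D, ∀ v ∈ D, u.length = v.length → ∀ m, (avoiders D u m).ncard = (avoiders D v m).ncard

theorem count_add_count_not (c : Bool) (w : List Bool) :
    w.count c + w.count (!c) = w.length := by
  cases c
  · exact List.count_false_add_count_true w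
  · exact List.count_true_add_count_false w

theorem exists_mem_length (hD : IsLower D) (hinf : D.Infinite) (n : ℕ) :
    ∃ w ∈ D, w.length = n := by
  have : ∃ w ∈ D, n ≤ w.length := by
    by_contra! h
    exact hinf ((List.finite_length_lt Bool n).subset h)
  obtain ⟨w, hw, hn⟩ := this
  exact ⟨w.take n, hD _ _ (List.take_sublist _ _) hw, by simp [hn]⟩

theorem replicate_mem_of_not (hD : IsLower D) (hinf : D.Infinite) {c : Bool} {n : ℕ}
    (h : List.replicate n c ∉ D) (m : ℕ) : List.replicate m (!c) ∈ D := by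
  obtain ⟨w, hw, hl⟩ := exists_mem_length hD hinf (n + m)
  have h1 : ¬ n ≤ w.count c := fun hc =>
    h (hD _ _ (List.replicate_sublist_iff.2 hc) hw)
  have h2 := count_add_count_not c w
  exact hD _ _ (List.replicate_sublist_iff.2 (by omega)) hw

/-- If c^n were missing, all powers of the other letter d would be present. As d^(n+1) avoids cc,
some word of length n + 1 in D avoids dd; it has at most one d, hence n letters c. -/
theorem replicate_mem (hD : IsLower D) (hinf : D.Infinite) (hW : IsWilf D)
    (h2 : ∀ u : List Bool, u.length = 2 → u ∈ D) (c : Bool) (n : ℕ) :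
    List.replicate n c ∈ D := by
  by_contra h
  have hm := replicate_mem_of_not hD hinf h
  have heq := hW (List.replicate 2 c) (h2 _ (by simp)) (List.replicate 2 (!c))
    (h2 _ (by simp)) (by simp) (n + 1)
  have hne : (avoiders D (List.replicate 2 c) (n + 1)).Nonempty := by
    refine ⟨List.replicate (n + 1) (!c), hm _, by simp, fun hs => ?_⟩
    have := List.eq_of_mem_replicate (hs.subset (by simp : c ∈ List.replicate 2 c))
    cases c <;> simp at this
  rw [← Set.ncard_pos (finite_avoiders _ _ _), heq, Set.ncard_pos (finite_avoiders _ _ _)] at hne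
  obtain ⟨w, hw, hl, ha⟩ := hne
  rw [List.replicate_sublist_iff] at ha
  have := count_add_count_not c w
  exact h (hD _ _ (List.replicate_sublist_iff.2 (by omega)) hw)

/-- For every `b` there is a word in `D` with a letter `L` and at least `b` letters `R`. -/
theorem exists_mem_true_mem (hD : IsLower D) (hinf : D.Infinite) (hW : IsWilf D)
    (h2 : ∀ u : List Bool, u.length = 2 → u ∈ D) (b : ℕ) :
    ∃ u ∈ D, true ∈ u ∧ (List.replicate b false).Sublist u := by
  have hrep := replicate_mem hD hinf hW h2
  -- Two words of length b + 1 avoid LR, so at least two avoid LL; one of these is not a power of R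
  -- and has exactly one L.
  have hsub : {List.replicate (b + 1) true, List.replicate (b + 1) false} ⊆
      avoiders D [true, false] (b + 1) := by
    rintro w (rfl | rfl)
    · exact ⟨hrep _ _, by simp, fun h => by
        simpa using List.eq_of_mem_replicate (h.subset (by simp : false ∈ [true, false]))⟩
    · exact ⟨hrep _ _, by simp, fun h => by
        simpa using List.eq_of_mem_replicate (h.subset (by simp : true ∈ [true, false]))⟩
  have h1 := Set.ncard_le_ncard hsub (finite_avoiders _ _ _)
  rw [Set.ncard_pair (by simp [List.replicate_succ]), hW _ (h2 [true, false] rfl)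
    (List.replicate 2 true) (h2 _ rfl) rfl] at h1
  obtain ⟨u, hu, hne⟩ := Set.exists_ne_of_one_lt_ncard h1 (List.replicate (b + 1) false)
  obtain ⟨hu, hl, ha⟩ := hu
  rw [List.replicate_sublist_iff] at ha
  have := count_add_count_not true u
  refine ⟨u, hu, ?_, List.replicate_sublist_iff.2 (by rw [Bool.not_true] at this; omega)⟩
  by_contra ht
  apply hne
  rw [← hl]
  exact List.eq_replicate_length.2 fun x hx => by
    cases x
    · rfl
    · exact absurd hx ht

theorem exists_sublist_many_true (hW : IsWilf D) (hrep : ∀ c n, List.replicate n c ∈ D)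
    {u : List Bool} (hu : u ∈ D) (ht : true ∈ u) (n : ℕ) :
    ∃ w ∈ D, u.Sublist w ∧ n ≤ w.count true := by
  obtain ⟨w, hw, hl, hs, hn⟩ := exists_sublist_of_ncard_eq (D := D) (c := true) (u := u)
    (m := u.length + n) (by omega) ht (hrep _ _) (hW _ hu _ (hrep _ _) (by simp) _)
  refine ⟨w, hw, hs, ?_⟩
  rw [List.replicate_sublist_iff] at hn
  have := count_add_count_not true w
  omega

/-- If `D` has words that contain arbitrarily long block words and arbitrarily many letters `L`,
then all words avoiding some pattern `L^i R L^r` lie in `D`. -/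
theorem exists_pat_avoiders_subset (hD : IsLower D) (k : ℕ)
    (h : ∀ b n, ∃ w ∈ D, (blockWord b (k + 1)).Sublist w ∧ n ≤ w.count true) :
    ∃ i r, i + r = k + 1 ∧ ∀ w, ¬ (pat i r).Sublist w → w ∈ D := by
  -- One i must serve all a. Otherwise each i fails at some `f i`, hence at all larger values by
  -- monotonicity, in particular at the sum of the `f i`. The block length is twice that sum, as
  -- `exists_starWord_sublist` requires.
  have key : ∃ i ≤ k + 1, ∀ a, starWord a i (k + 1 - i) ∈ D := by
    by_contra! hcon
    choose! f hf using hcon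
    obtain ⟨w, hw, hb, hn⟩ := h
      ((∑ i ∈ Finset.range (k + 2), f i) + ∑ i ∈ Finset.range (k + 2), f i)
      ((k + 1) * (2 * (∑ i ∈ Finset.range (k + 2), f i) + 2))
    obtain ⟨i, r, hir, hs⟩ := exists_starWord_sublist le_rfl k hb hn
    obtain rfl : r = k + 1 - i := by omega
    refine hf i (by omega) (hD _ _ ((starWord_mono ?_ _ _).trans hs) hw)
    exact Finset.single_le_sum (f := f) (fun _ _ => Nat.zero_le _)
      (Finset.mem_range.2 (by omega))
  obtain ⟨i, hi, ha⟩ := key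
  exact ⟨i, k + 1 - i, by omega, fun w hw => hD _ _ (sublist_starWord hw le_rfl) (ha _)⟩

/-- Relative to D, `u` and `v` have equally many avoiders; for `v` these are all its avoiders, and
over all words the two counts also agree. So D misses no avoider of `u`. -/
theorem avoiders_subset_of_one (hW : IsWilf D) {n : ℕ}
    (hn : ∀ u : List Bool, u.length = n → u ∈ D) {v : List Bool} (hv : v.length = n)
    (hvD : ∀ w : List Bool, ¬ v.Sublist w → w ∈ D) (u w : List Bool) (hu : u.length = n)
    (hw : ¬ u.Sublist w) : w ∈ D := by
  have h1 : avoiders D v w.length = avoiders Set.univ v w.length :=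
    Set.ext fun x => ⟨fun h => ⟨trivial, h.2⟩, fun h => ⟨hvD x h.2.2, h.2⟩⟩
  have h2 : avoiders D u w.length = avoiders Set.univ u w.length := by
    refine Set.eq_of_subset_of_ncard_le (fun x h => ⟨trivial, h.2⟩) ?_ (finite_avoiders _ _ _)
    rw [hW u (hn u hu) v (hn v hv) (hu.trans hv.symm), h1,
      ncard_avoiders_univ_congr _ u v (hu.trans hv.symm)]
  have h3 : w ∈ avoiders Set.univ u w.length := ⟨trivial, rfl, hw⟩
  rw [← h2] at h3
  exact h3.1

theorem count_true_blockWord (a k : ℕ) : (blockWord a (k + 1)).count true = k := by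
  induction k with
  | zero => simp [blockWord, List.count_replicate]
  | succ k ih => simp [blockWord, List.count_replicate, ih]

theorem avoiders_subset (hD : IsLower D) (hinf : D.Infinite) (hW : IsWilf D)
    (h2 : ∀ u : List Bool, u.length = 2 → u ∈ D) (k : ℕ) (u w : List Bool)
    (hu : u.length = k + 2) (hw : ¬ u.Sublist w) : w ∈ D := by
  have hrep := replicate_mem hD hinf hW h2
  induction k generalizing u w with
  | zero =>
    obtain ⟨i, r, hir, hp⟩ := exists_pat_avoiders_subset hD 0 fun b n => by
      obtain ⟨u, hu, ht, hb⟩ := exists_mem_true_mem hD hinf hW h2 b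
      obtain ⟨w, hw, hs, hc⟩ := exists_sublist_many_true hW hrep hu ht n
      exact ⟨w, hw, hb.trans hs, hc⟩
    exact avoiders_subset_of_one hW h2 (by rw [length_pat, hir]) hp u w hu hw
  | succ k ih =>
    obtain ⟨i, r, hir, hp⟩ := exists_pat_avoiders_subset hD (k + 1) fun b n => by
      have hc := count_true_blockWord b (k + 1)
      have hm : blockWord b (k + 1 + 1) ∈ D := by
        refine ih (List.replicate (k + 2) true) _ (by simp) fun h => ?_
        rw [List.replicate_sublist_iff] at h
        omega
      obtain ⟨w, hw, hs, hn⟩ := exists_sublist_many_true hW hrep hm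
        (List.count_pos_iff.1 (by omega)) n
      exact ⟨w, hw, hs, hn⟩
    -- A word of length k + 3 cannot contain both L^(k+2) and R^(k+2), so the induction hypothesis
    -- covers it.
    have hall : ∀ v : List Bool, v.length = k + 1 + 2 → v ∈ D := fun v hv => by
      have hc := count_add_count_not true v
      by_cases ht : k + 2 ≤ v.count true
      · refine ih (List.replicate (k + 2) false) _ (by simp) fun h => ?_
        rw [List.replicate_sublist_iff] at h
        rw [Bool.not_true] at hc
        omega
      · exact ih (List.replicate (k + 2) true) _ (by simp) fun h =>
          ht (List.replicate_sublist_iff.1 h)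
    exact avoiders_subset_of_one hW hall (by rw [length_pat, hir]) hp u w hu hw

/-- The only infinite uniquely-Wilf lower set of binary words containing all words of length two
is the set of all words. -/
theorem eq_univ_of_isWilf (hD : IsLower D) (hinf : D.Infinite) (hW : IsWilf D)
    (h2 : ∀ u : List Bool, u.length = 2 → u ∈ D) : D = Set.univ :=
  Set.eq_univ_of_forall fun w =>
    avoiders_subset hD hinf hW h2 w.length (List.replicate (w.length + 2) true) w (by simp)
      fun h => by simpa using h.length_le

end Class

end BinWord

/-! ### Unimodal permutations and binary words -/

namespace FinPerm

theorem Contains.refl (π : FinPerm) : Contains π π :=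
  ⟨RelEmbedding.refl _, fun _ _ => Iff.rfl⟩

theorem Contains.trans {π σ τ : FinPerm} (h₁ : Contains π σ) (h₂ : Contains σ τ) :
    Contains π τ := by
  obtain ⟨f, hf⟩ := h₁
  obtain ⟨g, hg⟩ := h₂
  exact ⟨f.trans g, fun i j => (hf i j).trans (hg _ _)⟩

theorem Contains.size_le {π σ : FinPerm} (h : Contains π σ) : π.size ≤ σ.size := by
  obtain ⟨f, -⟩ := h
  have := Fintype.card_le_of_injective f f.injective
  rwa [Fintype.card_fin, Fintype.card_fin] at this

theorem isPermClass_Av (X : Set FinPerm) : IsPermClass (Av X) :=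
  fun _ _ h hσ _ hX hc => hσ _ hX (hc.trans h)

/-- Two injective functions ordering all increasing pairs alike order all pairs alike. -/
theorem lt_iff_lt_of_forall_lt {ι α β : Type*} [LinearOrder ι] [LinearOrder α] [LinearOrder β]
    {a : ι → α} {b : ι → β} (ha : Function.Injective a) (hb : Function.Injective b)
    (h : ∀ i j, i < j → (a i < a j ↔ b i < b j)) (i j : ι) : a i < a j ↔ b i < b j := by
  rcases lt_trichotomy i j with hij | rfl | hij
  · exact h i j hij
  · simp
  · have h1 := not_congr (h j i hij)
    rw [not_lt, not_lt] at h1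
    rw [lt_iff_le_and_ne, lt_iff_le_and_ne, h1]
    simp [ha.ne hij.ne', hb.ne hij.ne']

theorem contains_mk_iff {n m : ℕ} {p : Equiv.Perm (Fin n)} {q : Equiv.Perm (Fin m)} :
    Contains ⟨n, p⟩ ⟨m, q⟩ ↔ ∃ f : Fin n → Fin m, StrictMono f ∧
      ∀ i j, i < j → (p i < p j ↔ q (f i) < q (f j)) := by
  constructor
  · rintro ⟨f, hf⟩
    exact ⟨f, f.strictMono, fun i j _ => hf i j⟩
  · rintro ⟨f, hf, h⟩
    exact ⟨OrderEmbedding.ofStrictMono f hf, lt_iff_lt_of_forall_lt p.injective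
      (q.injective.comp hf.injective) h⟩

/-- Containment is preserved by inversion. -/
theorem Contains.inv {n m : ℕ} {p : Equiv.Perm (Fin n)} {q : Equiv.Perm (Fin m)}
    (h : Contains ⟨n, p⟩ ⟨m, q⟩) : Contains ⟨n, p.symm⟩ ⟨m, q.symm⟩ := by
  obtain ⟨f, hf⟩ := h
  change ∀ i j : Fin n, p i < p j ↔ q (f i) < q (f j) at hf
  refine contains_mk_iff.2 ⟨fun v => q (f (p.symm v)), fun v x hvx => ?_, fun v x _ => ?_⟩
  · exact (hf (p.symm v) (p.symm x)).1 (by simpa using hvx)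
  · rw [Equiv.symm_apply_apply, Equiv.symm_apply_apply]
    exact f.lt_iff_lt.symm

/-- Containment in terms of the values of the two permutations. -/
theorem contains_mk_iff_values {n m : ℕ} {p : Equiv.Perm (Fin n)} {q : Equiv.Perm (Fin m)} :
    Contains ⟨n, p⟩ ⟨m, q⟩ ↔ ∃ g : Fin n → Fin m, StrictMono g ∧
      ∀ v x, v < x → (p.symm v < p.symm x ↔ q.symm (g v) < q.symm (g x)) :=
  Iff.trans ⟨Contains.inv, fun h => Contains.inv (p := p.symm) (q := q.symm) h⟩ contains_mk_iff

/-! ### The permutation of a binary word -/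

/-- A rank function on values for the unimodal permutation of a word. -/
def wordKey (w : List Bool) (v : Fin (w.length + 1)) : ℕ :=
  -- The largest value has no letter; both branches agree there, so the default is immaterial.
  if w.getD v true then v else 2 * w.length - v

/-- The unimodal permutation in which the value `v` is to the left of all larger values if the
letter `v` of `w` is `true`, and to the right of them otherwise. -/
def wordPerm (w : List Bool) : Equiv.Perm (Fin (w.length + 1)) := Tuple.sort (wordKey w)

/-- The unimodal permutation of a word, as a finite permutation. -/
def ofWord (w : List Bool) : FinPerm := ⟨w.length + 1, wordPerm w⟩

theorem wordKey_lt_iff {w : List Bool} {v x : Fin (w.length + 1)} (h : v < x) :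
    wordKey w v < wordKey w x ↔ w.getD v true = true := by
  have h1 : (v : ℕ) < x := h
  have h2 := x.2
  unfold wordKey
  split_ifs with h3 h4 h4 <;> simp only [h3] <;> simp <;> omega

theorem wordKey_injective (w : List Bool) : Function.Injective (wordKey w) := by
  have aux : ∀ v x : Fin (w.length + 1), v < x → wordKey w v ≠ wordKey w x := by
    intro v x h
    have h1 : (v : ℕ) < x := h
    have h2 := x.2
    unfold wordKey
    split_ifs <;> omega
  intro v x h
  rcases lt_trichotomy v x with hlt | heq | hlt
  · exact absurd h (aux _ _ hlt)
  · exact heq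
  · exact absurd h.symm (aux _ _ hlt)

theorem wordPerm_symm_lt_iff {w : List Bool} {v x : Fin (w.length + 1)} (h : v < x) :
    (wordPerm w).symm v < (wordPerm w).symm x ↔ w.getD v true = true := by
  have hmono : StrictMono (wordKey w ∘ wordPerm w) :=
    (Tuple.monotone_sort _).strictMono_of_injective
      ((wordKey_injective w).comp (wordPerm w).injective)
  rw [← wordKey_lt_iff h, ← hmono.lt_iff_lt]
  simp

/-- Containment of unimodal permutations is the subword order. -/
theorem contains_ofWord_iff {u w : List Bool} :
    Contains (ofWord u) (ofWord w) ↔ u.Sublist w := by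
  rw [ofWord, ofWord, contains_mk_iff_values, List.sublist_iff_exists_fin_orderEmbedding_get_eq]
  constructor
  · rintro ⟨g, hmono, hg⟩
    have hlast : ∀ i : Fin u.length, g i.castSucc < g (Fin.last _) := fun i =>
      hmono (Fin.castSucc_lt_last i)
    have hlt : ∀ i : Fin u.length, (g i.castSucc : ℕ) < w.length := fun i => by
      have h1 : (g i.castSucc : ℕ) < g (Fin.last _) := hlast i
      have h2 := (g (Fin.last _)).2
      omega
    refine ⟨OrderEmbedding.ofStrictMono (fun i => ⟨g i.castSucc, hlt i⟩) fun i j hij => ?_,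
      fun i => ?_⟩
    · exact hmono (Fin.castSucc_lt_castSucc_iff.2 hij)
    -- Comparing a value with the largest one reads off its letter.
    · have h := hg i.castSucc (Fin.last _) (Fin.castSucc_lt_last i)
      rw [wordPerm_symm_lt_iff (Fin.castSucc_lt_last i), wordPerm_symm_lt_iff (hlast i),
        List.getD_eq_getElem _ _ (hlt i)] at h
      have h' : u[i] = w[(g i.castSucc : ℕ)]'(hlt i) := Bool.eq_iff_iff.2 (by simpa using h)
      exact h'
  · rintro ⟨g, hg⟩
    have hmono : StrictMono (Fin.lastCases (Fin.last w.length)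
        (fun i => (g i).castSucc) : Fin (u.length + 1) → Fin (w.length + 1)) := by
      intro i j hij
      induction i using Fin.lastCases with
      | last => exact absurd hij (Fin.le_last j).not_gt
      | cast i =>
        induction j using Fin.lastCases with
        | last => simp
        | cast j => simpa using hij
    refine ⟨_, hmono, fun v x hvx => ?_⟩
    rw [wordPerm_symm_lt_iff hvx, wordPerm_symm_lt_iff (hmono hvx)]
    induction v using Fin.lastCases with
    | last => exact absurd hvx (Fin.le_last x).not_gt
    | cast v => simpa using Bool.eq_iff_iff.1 (hg v)

theorem size_ofWord (w : List Bool) : (ofWord w).size = w.length + 1 := rfl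

theorem ofWord_injective : Function.Injective ofWord := fun _ _ h =>
  (contains_ofWord_iff.1 (h ▸ Contains.refl _)).antisymm
    (contains_ofWord_iff.1 (h ▸ Contains.refl _))

/-- The class of unimodal permutations. -/
def unimodal : Set FinPerm := Av {p213, p312}

theorem mem_unimodal_iff {σ : FinPerm} :
    σ ∈ unimodal ↔ ∀ i j k : Fin σ.1, i < j → j < k → ¬ (σ.2 j < σ.2 i ∧ σ.2 j < σ.2 k) := by
  have mono3 : ∀ {i j k : Fin σ.1}, i < j → j < k → StrictMono ![i, j, k] := fun h₁ h₂ =>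
    Fin.strictMono_iff_lt_succ.2 (by intro t; fin_cases t <;> simpa)
  have pairs : ∀ {P : Fin 3 → Fin 3 → Prop}, P 0 1 → P 0 2 → P 1 2 → ∀ s t, s < t → P s t := by
    intro P h₁ h₂ h₃ s t hst
    fin_cases s <;> fin_cases t <;> first | exact absurd hst (by decide) | assumption
  constructor
  · intro h i j k hij hjk ⟨h1, h2⟩
    rcases lt_trichotomy (σ.2 i) (σ.2 k) with h3 | h3 | h3
    · exact h p213 (by simp) (contains_mk_iff.2 ⟨_, mono3 hij hjk, pairs
        (iff_of_false (by decide) h1.not_gt) (iff_of_true (by decide) h3)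
        (iff_of_true (by decide) h2)⟩)
    · exact absurd (σ.2.injective h3) (hij.trans hjk).ne
    · exact h p312 (by simp) (contains_mk_iff.2 ⟨_, mono3 hij hjk, pairs
        (iff_of_false (by decide) h1.not_gt) (iff_of_false (by decide) h3.not_gt)
        (iff_of_true (by decide) h2)⟩)
  · rintro h π (rfl | rfl) ⟨f, hf⟩
    · exact h _ _ _ (f.lt_iff_lt.2 (by decide : (0 : Fin 3) < 1))
        (f.lt_iff_lt.2 (by decide : (1 : Fin 3) < 2))
        ⟨(hf (1 : Fin 3) (0 : Fin 3)).1 (by decide), (hf (1 : Fin 3) (2 : Fin 3)).1 (by decide)⟩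
    · exact h _ _ _ (f.lt_iff_lt.2 (by decide : (0 : Fin 3) < 1))
        (f.lt_iff_lt.2 (by decide : (1 : Fin 3) < 2))
        ⟨(hf (1 : Fin 3) (0 : Fin 3)).1 (by decide), (hf (1 : Fin 3) (2 : Fin 3)).1 (by decide)⟩

theorem ofWord_mem_unimodal (w : List Bool) : ofWord w ∈ unimodal := by
  rw [mem_unimodal_iff]
  change ∀ i j k : Fin (w.length + 1), i < j → j < k →
    ¬ (wordPerm w j < wordPerm w i ∧ wordPerm w j < wordPerm w k)
  rintro i j k hij hjk ⟨h1, h2⟩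
  have e1 := wordPerm_symm_lt_iff h1
  have e2 := wordPerm_symm_lt_iff h2
  simp only [Equiv.symm_apply_apply] at e1 e2
  exact hij.not_gt (e1.2 (e2.1 hjk))

/-- Every nonempty unimodal permutation comes from a word. -/
theorem exists_ofWord_eq {σ : FinPerm} (hσ : σ ∈ unimodal) (h0 : 0 < σ.size) :
    ∃ w, ofWord w = σ := by
  obtain ⟨n, p⟩ := σ
  rcases n with _ | n
  · exact absurd h0 (lt_irrefl 0)
  rw [mem_unimodal_iff] at hσ
  change ∀ i j k : Fin (n + 1), i < j → j < k → ¬ (p j < p i ∧ p j < p k) at hσ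
  obtain ⟨w, hw, hwp⟩ : ∃ w : List Bool, w.length = n ∧ ∀ v x : Fin (n + 1), v < x →
      (p.symm v < p.symm x ↔ w.getD v true = true) := by
    refine ⟨List.ofFn fun v : Fin n => decide (p.symm v.castSucc < p.symm (Fin.last n)),
      by simp, fun v x hvx => ?_⟩
    induction v using Fin.lastCases with
    | last => exact absurd hvx (Fin.le_last x).not_gt
    | cast v =>
      have hne : ∀ y, v.castSucc < y → p.symm v.castSucc ≠ p.symm y := fun y hy => by
        simpa using hy.ne
      -- If `x` and the maximum were on different sides of the smaller value `v`, then `v` would be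
      -- a valley.
      have hval := hσ (p.symm x) (p.symm v.castSucc) (p.symm (Fin.last n))
      have hval' := hσ (p.symm (Fin.last n)) (p.symm v.castSucc) (p.symm x)
      simp only [Equiv.apply_symm_apply, hvx, Fin.castSucc_lt_last, and_self, not_true_eq_false,
        imp_false, not_lt] at hval hval'
      have e1 : (p.symm v.castSucc < p.symm x ↔ p.symm v.castSucc < p.symm (Fin.last n)) := by
        constructor
        · intro h
          by_contra hc
          exact absurd h (hval' (lt_of_le_of_ne (not_lt.1 hc)
            (hne _ (Fin.castSucc_lt_last v)).symm)).not_gt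
        · intro h
          by_contra hc
          exact absurd h (hval (lt_of_le_of_ne (not_lt.1 hc) (hne _ hvx).symm)).not_gt
      rw [e1]
      simp
  subst hw
  refine ⟨w, ?_⟩
  have hlt : ∀ v x, (wordPerm w).symm v < (wordPerm w).symm x ↔ p.symm v < p.symm x :=
    lt_iff_lt_of_forall_lt (wordPerm w).symm.injective p.symm.injective fun v x h => by
      rw [wordPerm_symm_lt_iff h, hwp v x h]
  have hmono : StrictMono fun i => (wordPerm w).symm (p i) := fun i j hij =>
    (hlt _ _).2 (by simpa using hij)
  have hid : (fun i => (wordPerm w).symm (p i)) = id := by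
    refine (StrictMono.range_inj hmono strictMono_id).1 ?_
    rw [Set.range_id]
    exact Set.range_eq_univ.2 ((wordPerm w).symm.surjective.comp p.surjective)
  have : wordPerm w = p := Equiv.ext fun i =>
    ((Equiv.symm_apply_eq _).1 (congrFun hid i)).symm
  rw [ofWord, this]

/-! ### Transfer of classes and enumeration to words -/

/-- The words of the nonempty permutations in `C`. -/
def words (C : Set FinPerm) : Set (List Bool) := {w | ofWord w ∈ C}

theorem inter_Av_ofWord_inter_ofSize {C : Set FinPerm} (hC : C ⊆ unimodal) (u : List Bool)
    (m : ℕ) : (C ∩ Av {ofWord u}) ∩ ofSize (m + 1) =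
      ofWord '' BinWord.avoiders (words C) u m := by
  ext σ
  constructor
  · rintro ⟨⟨h1, h2⟩, h3⟩
    obtain ⟨w, rfl⟩ := exists_ofWord_eq (hC h1) (by rw [show σ.size = m + 1 from h3]; omega)
    refine ⟨w, ⟨h1, ?_, fun h => h2 _ rfl (contains_ofWord_iff.2 h)⟩, rfl⟩
    exact Nat.succ_injective h3
  · rintro ⟨w, ⟨h1, h2, h3⟩, rfl⟩
    refine ⟨⟨h1, ?_⟩, congrArg (· + 1) h2⟩
    rintro _ rfl h
    exact h3 (contains_ofWord_iff.1 h)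

theorem enumSeq_inter_Av_ofWord {C : Set FinPerm} (hC : C ⊆ unimodal) (u : List Bool) (m : ℕ) :
    enumSeq (C ∩ Av {ofWord u}) (m + 1) = (BinWord.avoiders (words C) u m).ncard := by
  rw [enumSeq, inter_Av_ofWord_inter_ofSize hC, Set.ncard_image_of_injective _ ofWord_injective]

theorem inter_Av_ofWord_inter_ofSize_zero (C : Set FinPerm) (u : List Bool) :
    (C ∩ Av {ofWord u}) ∩ ofSize 0 = C ∩ ofSize 0 := by
  ext σ
  refine ⟨fun h => ⟨h.1.1, h.2⟩, fun h => ⟨⟨h.1, ?_⟩, h.2⟩⟩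
  rintro _ rfl hc
  have h1 := hc.size_le
  rw [show σ.size = 0 from h.2] at h1
  exact absurd h1 (by simp [size_ofWord])

theorem eq_of_size_zero {π σ : FinPerm} (hπ : π.size = 0) (hσ : σ.size = 0) : π = σ := by
  obtain ⟨n, p⟩ := π
  obtain ⟨m, q⟩ := σ
  change n = 0 at hπ
  change m = 0 at hσ
  subst hπ hσ
  exact congrArg _ (Subsingleton.elim p q)

theorem uniquelyWilf_iff {C : Set FinPerm} (hC : C ⊆ unimodal) :
    UniquelyWilf C ↔ BinWord.IsWilf (words C) := by
  constructor
  · intro h u hu v hv huv m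
    rw [← enumSeq_inter_Av_ofWord hC, ← enumSeq_inter_Av_ofWord hC]
    exact congrFun (h (u.length + 1) _ ⟨hu, rfl⟩ _ ⟨hv, congrArg (· + 1) huv.symm⟩) _
  · rintro h n π ⟨hπ, hπn⟩ σ ⟨hσ, hσn⟩
    change π.size = n at hπn
    change σ.size = n at hσn
    rcases n with _ | n
    · rw [eq_of_size_zero hπn hσn]
      rfl
    obtain ⟨u, rfl⟩ := exists_ofWord_eq (hC hπ) (by omega)
    obtain ⟨v, rfl⟩ := exists_ofWord_eq (hC hσ) (by omega)
    rw [size_ofWord] at hπn hσn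
    funext m
    rcases m with _ | m
    · rw [enumSeq, enumSeq, inter_Av_ofWord_inter_ofSize_zero, inter_Av_ofWord_inter_ofSize_zero]
    · rw [enumSeq_inter_Av_ofWord hC, enumSeq_inter_Av_ofWord hC]
      exact h u hπ v hσ (by omega) m

theorem words_unimodal : words unimodal = Set.univ :=
  Set.eq_univ_of_forall ofWord_mem_unimodal

theorem uniquelyWilf_unimodal : UniquelyWilf unimodal :=
  (uniquelyWilf_iff subset_rfl).2 (words_unimodal ▸
    fun u _ v _ h m => BinWord.ncard_avoiders_univ_congr m u v h)

theorem infinite_unimodal : unimodal.Infinite :=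
  (Set.infinite_range_of_injective ofWord_injective).mono
    (Set.range_subset_iff.2 ofWord_mem_unimodal)

theorem infinite_words {C : Set FinPerm} (hC : C ⊆ unimodal) (hinf : C.Infinite) :
    (words C).Infinite := by
  intro hfin
  refine hinf (((hfin.image ofWord).union (finite_inter_ofSize C 0)).subset fun σ hσ => ?_)
  rcases Nat.eq_zero_or_pos σ.size with h | h
  · exact Or.inr ⟨hσ, h⟩
  · obtain ⟨w, rfl⟩ := exists_ofWord_eq (hC hσ) h
    exact Or.inl ⟨w, hσ, rfl⟩

theorem empty_contains {π : FinPerm} (h : π.size = 0) (σ : FinPerm) : Contains π σ := by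
  obtain ⟨n, p⟩ := π
  change n = 0 at h
  subst h
  exact ⟨OrderEmbedding.ofStrictMono (fun i => i.elim0) fun i => i.elim0, fun i => i.elim0⟩

/-- The only infinite uniquely-Wilf subclass of the unimodal permutations with all words of
length two is the class of all unimodal permutations. -/
theorem eq_unimodal {C : Set FinPerm} (hcl : IsPermClass C) (hC : C ⊆ unimodal)
    (hinf : C.Infinite) (hW : UniquelyWilf C)
    (h2 : ∀ u : List Bool, u.length = 2 → ofWord u ∈ C) : C = unimodal := by
  have huniv : words C = Set.univ := BinWord.eq_univ_of_isWilf
    (fun u w h hw => hcl _ _ (contains_ofWord_iff.2 h) hw) (infinite_words hC hinf)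
    ((uniquelyWilf_iff hC).1 hW) h2
  refine hC.antisymm fun σ hσ => ?_
  rcases Nat.eq_zero_or_pos σ.size with h | h
  · exact hcl σ _ (empty_contains h _) (huniv ▸ Set.mem_univ [] : [] ∈ words C)
  · obtain ⟨w, rfl⟩ := exists_ofWord_eq hσ h
    exact (huniv ▸ Set.mem_univ w : w ∈ words C)

/-! ### Sizes at most three and the upper class -/

theorem eq_of_size_three {σ : FinPerm} (h : σ.size = 3) :
    σ = p123 ∨ σ = p132 ∨ σ = p213 ∨ σ = p231 ∨ σ = p312 ∨ σ = p321 := by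
  obtain ⟨n, p⟩ := σ
  change n = 3 at h
  subst h
  have key : ∀ a b c : Fin 3, a ≠ b → a ≠ c → b ≠ c →
      ![a, b, c] = ![0, 1, 2] ∨ ![a, b, c] = ![0, 2, 1] ∨ ![a, b, c] = ![1, 0, 2] ∨
      ![a, b, c] = ![1, 2, 0] ∨ ![a, b, c] = ![2, 0, 1] ∨ ![a, b, c] = ![2, 1, 0] := by
    decide
  have hp : (p : Fin 3 → Fin 3) = ![p 0, p 1, p 2] := by
    funext i
    fin_cases i <;> rfl
  have ext' : ∀ q : Equiv.Perm (Fin 3), (p : Fin 3 → Fin 3) = q →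
      (⟨3, p⟩ : FinPerm) = ⟨3, q⟩ := fun q hq => by
    rw [Equiv.coe_fn_injective hq]
  have := key (p 0) (p 1) (p 2) (by simp) (by simp) (by simp)
  rw [← hp] at this
  rcases this with h | h | h | h | h | h
  · exact Or.inl (ext' _ h)
  · exact Or.inr (Or.inl (ext' _ h))
  · exact Or.inr (Or.inr (Or.inl (ext' _ h)))
  · exact Or.inr (Or.inr (Or.inr (Or.inl (ext' _ h))))
  · exact Or.inr (Or.inr (Or.inr (Or.inr (Or.inl (ext' _ h)))))
  · exact Or.inr (Or.inr (Or.inr (Or.inr (Or.inr (ext' _ h)))))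

theorem ofWord_mem_of_length_two {F : Set FinPerm}
    (hF : F ∩ ofSize 3 = {p123, p132, p231, p321}) {u : List Bool} (hu : u.length = 2) :
    ofWord u ∈ F := by
  have h3 : (ofWord u).size = 3 := by rw [size_ofWord, hu]
  have hmem := ofWord_mem_unimodal u
  have : ofWord u ∈ F ∩ ofSize 3 := by
    rw [hF]
    rcases eq_of_size_three h3 with h | h | h | h | h | h
    · simp [h]
    · simp [h]
    · exact absurd (h ▸ Contains.refl _) (hmem p213 (by simp))
    · simp [h]
    · exact absurd (h ▸ Contains.refl _) (hmem p312 (by simp))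
    · simp [h]
  exact this.1

theorem unimodal_inter_sizeLE {F : Set FinPerm} (hF : IsPermClass F) (hF_le : F ⊆ sizeLE 3)
    (hF_three : F ∩ ofSize 3 = {p123, p132, p231, p321}) : unimodal ∩ sizeLE 3 = F := by
  ext σ
  constructor
  · rintro ⟨h1, h2⟩
    change σ.size ≤ 3 at h2
    rcases Nat.eq_zero_or_pos σ.size with h | h
    · exact hF _ _ (empty_contains h _)
        (ofWord_mem_of_length_two hF_three (u := [true, true]) rfl)
    · obtain ⟨w, rfl⟩ := exists_ofWord_eq h1 h
      rw [size_ofWord] at h2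
      -- Padding to length 2 reaches a permutation of size 3 in F, from which closure descends.
      refine hF _ (ofWord (w ++ List.replicate (2 - w.length) true))
        (contains_ofWord_iff.2 (List.sublist_append_left _ _))
        (ofWord_mem_of_length_two hF_three ?_)
      simp
      omega
  · refine fun h => ⟨?_, hF_le h⟩
    rintro π (rfl | rfl) hc
    · have h1 : p213 ∈ F ∩ ofSize 3 := ⟨hF _ _ hc h, rfl⟩
      rw [hF_three] at h1
      revert h1
      simp only [Set.mem_insert_iff, Set.mem_singleton_iff]
      decide
    · have h1 : p312 ∈ F ∩ ofSize 3 := ⟨hF _ _ hc h, rfl⟩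
      rw [hF_three] at h1
      revert h1
      simp only [Set.mem_insert_iff, Set.mem_singleton_iff]
      decide

/-- Both forbidden patterns have size 3, so any violation already occurs in that size. -/
theorem subset_unimodal_of_inter_sizeLE {C : Set FinPerm} (hC : IsPermClass C)
    (h : C ∩ sizeLE 3 ⊆ unimodal) : C ⊆ unimodal := by
  intro σ hσ π hπ hc
  have h3 : π ∈ sizeLE 3 := by rcases hπ with rfl | rfl <;> exact le_refl 3
  exact h ⟨hC _ _ hc hσ, h3⟩ π hπ (Contains.refl π)

theorem upper_eq_unimodal {F : Set FinPerm} (h : unimodal ∩ sizeLE 3 = F) :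
    upper 3 F = unimodal := by
  subst h
  refine Set.Subset.antisymm (subset_unimodal_of_inter_sizeLE (isPermClass_Av _) ?_) ?_
  · rintro σ ⟨h1, h2⟩
    by_contra hc
    exact h1 σ ⟨h2, fun h => hc h.1⟩ (Contains.refl σ)
  · rintro σ hσ π ⟨h1, h2⟩ hc
    exact h2 ⟨isPermClass_Av _ _ _ hc hσ, h1⟩

end FinPerm

theorem mainTheorem3 (F : Set FinPerm) (hF : FinPerm.IsPermClass F)
    (hF_le : F ⊆ FinPerm.sizeLE 3)
    (hF_three : F ∩ FinPerm.ofSize 3 =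
      {FinPerm.p123, FinPerm.p132, FinPerm.p231, FinPerm.p321}) :
    FinPerm.upper 3 F = FinPerm.Av {FinPerm.p213, FinPerm.p312} ∧
    ∀ C : Set FinPerm,
      (FinPerm.IsPermClass C ∧ C.Infinite ∧ FinPerm.UniquelyWilf C ∧
        C ∩ FinPerm.sizeLE 3 = F) ↔ C = FinPerm.upper 3 F := by
  have hU := FinPerm.unimodal_inter_sizeLE hF hF_le hF_three
  have hup := FinPerm.upper_eq_unimodal hU
  refine ⟨hup, fun C => ?_⟩
  rw [hup]
  constructor
  · rintro ⟨hcl, hinf, hW, hCF⟩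
    refine FinPerm.eq_unimodal hcl (FinPerm.subset_unimodal_of_inter_sizeLE hcl ?_) hinf hW
      fun u hu => ?_
    · rw [hCF, ← hU]
      exact Set.inter_subset_left
    · have := FinPerm.ofWord_mem_of_length_two hF_three hu
      rw [← hCF] at this
      exact this.1
  · rintro rfl
    exact ⟨FinPerm.isPermClass_Av _, FinPerm.infinite_unimodal, FinPerm.uniquelyWilf_unimodal, hU⟩
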